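/- **Compactness Theorem.** For a metric space $(X,d)$ with basepoint $*$ put $(x\cdot y)=\tfrac12\big(d(*,x)+d(*,y)-d(x,y)\big)$; $(X,*)$ is $\delta$-hyperbolic ($\delta\ge 0$) if $(x\cdot y)\ge\min\big((x\cdot z),(y\cdot z)\big)-\delta$ for all $x,y,z\in X$. Let $X$ be a non-empty proper $\delta$-hyperbolic metric space (for some basepoint) that is geodesic or, more generally, coarsely geodesic: there is $C\ge 0$ such that for all $x,y\in X$ and $t\in[0,d(x,y)]$ some $z\in X$ satisfies $|d(x,z)-t|\le C$ and $|d(z,y)-(d(x,y)-t)|\le C$. (Geodesic spaces satisfy this with $C=0$, word metrics on finitely generated groups with $C=1$.) Assume that $\mathrm{Isom}(X)$ acts cocompactly on $X$, i.e. there is a compact $K\subset X$ whose $\mathrm{Isom}(X)$-translates cover $X$. Let $G$ be a group with a finite generating set $S$, and let $\rho_i:G\to\mathrm{Isom}(X)$, $i=1,2,\dots$, be representations that are non-elementary, i.e. $\rho_i(G)$ fixes no point of the Gromov boundary of $X$ (no class of sequences $(u_n)$ in $X$ with $(u_m\cdot u_n)\to\infty$, where $(u_n)\sim(v_n)$ if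 $(u_m\cdot v_n)\to\infty$ as $m,n\to\infty$). Then, after passing to a subsequence, one of the following holds. 1. There are isometries $\phi_i\in\mathrm{Isom}(X)$ such that the conjugates $g\mapsto\phi_i\rho_i(g)\phi_i^{-1}$ converge in the compact-open topology to a representation $\rho:G\to\mathrm{Isom}(X)$. 2. For each $i$ there is a point $x_i\in X$, not fixed by $\rho_i(G)$, that is centrally located for $\rho_i$ and $S$, i.e. at which the function $x\mapsto\max_{g\in S}d(x,\rho_i(g)x)$ attains its global minimum, such that the based $G$-spaces $(X,x_i,\rho_i)$ converge to a based $G$-space $(T,*,\rho)$, where $T$ is an $\mathbb R$-tree and the isometric action $\rho$ of $G$ on $T$ has no global fixed point. Here a based $G$-space $(Y,*,\rho)$ is a metric space $Y$ with an isometric action $\rho$ of $G$ and a basepoint $*$ not fixed by all of $G$. It induces the $G$-equivariant, not identically zero pseudometric $d(g,h)=d_Y(\rho(g)*,\rho(h)*)$ on $G$, and convergence of based $G$-spaces means convergence of the classes of these pseudometrics in the space of all $G$-equivariant, not identically zero pseudometrics on the discrete group $G$ (with the compact-open topology, i.e. pointwise convergence) modulo scaling by positive reals, with the quotient topology. An $\mathbb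 R$-tree is a metric space in which any two points are joined by a unique arc and this arc is a geodesic segment. -/

import Mathlib

universe u v

open Filter Topology
open scoped NNReal

/-! ### Arcs, geodesic segments, real trees -/

/-- `A` is an arc from `x` to `y`: the image of a topological embedding of a closed interval
(possibly a single point) with these endpoints. -/
def IsArc {X : Type*} [MetricSpace X] (A : Set X) (x y : X) : Prop :=
  ∃ (a b : ℝ) (hab : a ≤ b) (α : Set.Icc a b → X), IsEmbedding α ∧
    α ⟨a, Set.left_mem_Icc.2 hab⟩ = x ∧ α ⟨b, Set.right_mem_Icc.2 hab⟩ = y ∧ Set.range α = A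

/-- `A` is a geodesic segment from `x` to `y`: the image of an isometric embedding of a closed
interval with these endpoints. -/
def IsGeodesicSegment {X : Type*} [MetricSpace X] (A : Set X) (x y : X) : Prop :=
  ∃ (a b : ℝ) (hab : a ≤ b) (α : Set.Icc a b → X), Isometry α ∧
    α ⟨a, Set.left_mem_Icc.2 hab⟩ = x ∧ α ⟨b, Set.right_mem_Icc.2 hab⟩ = y ∧ Set.range α = A

/-- Any two points are joined by a unique arc, and this arc is a geodesic segment. -/
def IsRTree (X : Type*) [MetricSpace X] : Prop :=
  ∀ x y : X, (∃! A : Set X, IsArc A x y) ∧ ∀ A : Set X, IsArc A x y → IsGeodesicSegment A x y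

/-! ### Hyperbolicity and points at infinity -/

/-- The Gromov product `(x · y)` with respect to the basepoint `o`. -/
noncomputable def gromovProduct {X : Type*} [MetricSpace X] (o x y : X) : ℝ :=
  (dist o x + dist o y - dist x y) / 2

/-- The based metric space `(X, o)` is `δ`-hyperbolic. -/
def IsGromovHyperbolic {X : Type*} [MetricSpace X] (δ : ℝ) (o : X) : Prop :=
  0 ≤ δ ∧ ∀ x y z : X,
    min (gromovProduct o x z) (gromovProduct o y z) - δ ≤ gromovProduct o x y

/-- `X` is geodesic up to a bounded error, i.e. it has no big holes. Geodesic spaces satisfy this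
with `C = 0`, word metrics on finitely generated groups with `C = 1`. -/
def IsCoarselyGeodesic (X : Type*) [MetricSpace X] : Prop :=
  ∃ C : ℝ, ∀ x y : X, ∀ t ∈ Set.Icc (0 : ℝ) (dist x y), ∃ z : X,
    |dist x z - t| ≤ C ∧ |dist z y - (dist x y - t)| ≤ C

/-- `(u m · v n) → ∞` as `m, n → ∞`. For `v = u` this says that `u` converges to a point at
infinity, and for two such sequences that their points at infinity coincide. -/
def AsymptoticAtInfinity {X : Type*} [MetricSpace X] (o : X) (u v : ℕ → X) : Prop :=
  Tendsto (fun p : ℕ × ℕ => gromovProduct o (u p.1) (v p.2)) atTop atTop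

/-- The action `ρ` fixes a point at infinity of `X`, i.e. the class of some sequence `u` that
converges to infinity (in the sense of Gromov). -/
def FixesPointAtInfinity {G X : Type*} [Group G] [MetricSpace X] (o : X)
    (ρ : G →* (X ≃ᵢ X)) : Prop :=
  ∃ u : ℕ → X, AsymptoticAtInfinity o u u ∧
    ∀ g : G, AsymptoticAtInfinity o (fun n => ρ g (u n)) u

def IsNonElementary {G X : Type*} [Group G] [MetricSpace X] (o : X)
    (ρ : G →* (X ≃ᵢ X)) : Prop :=
  ¬ FixesPointAtInfinity o ρ

/-- There is a compact set whose translates under the isometry group cover `X`. -/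
def IsomActsCocompactly (X : Type*) [MetricSpace X] : Prop :=
  ∃ K : Set X, IsCompact K ∧ (⋃ φ : X ≃ᵢ X, φ '' K) = Set.univ

/-! ### Centrally located points -/

/-- `F(x) = max_{g ∈ S} d(x, ρ(g) x)`, with values in `[0, ∞)`. -/
noncomputable def maxDisplacement {G X : Type*} [Group G] [MetricSpace X] (S : Finset G)
    (ρ : G →* (X ≃ᵢ X)) (x : X) : ℝ≥0 :=
  S.sup fun g => nndist x (ρ g x)

def IsCentrallyLocated {G X : Type*} [Group G] [MetricSpace X] (S : Finset G)
    (ρ : G →* (X ≃ᵢ X)) (x : X) : Prop :=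
  ∀ y : X, maxDisplacement S ρ x ≤ maxDisplacement S ρ y

/-! ### Convergence of representations -/

/-- The conjugate representation `g ↦ φ ρ(g) φ⁻¹`. -/
def conjRep {G X : Type*} [Group G] [MetricSpace X] (ρ : G →* (X ≃ᵢ X)) (φ : X ≃ᵢ X) :
    G →* (X ≃ᵢ X) :=
  (MulAut.conj φ).toMonoidHom.comp ρ

/-- An isometry as an element of `C(X, X)`, which carries the compact-open topology. -/
def isomToContinuousMap {X : Type*} [MetricSpace X] (f : X ≃ᵢ X) : C(X, X) :=
  ⟨f, f.continuous⟩

/-- Convergence in the compact-open topology: as `G` is discrete, this is convergence of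
`σ i g` to `τ g` in the compact-open topology, for each `g`. -/
def ConvergesCompactOpen {G X : Type*} [Group G] [MetricSpace X]
    (σ : ℕ → G →* (X ≃ᵢ X)) (τ : G →* (X ≃ᵢ X)) : Prop :=
  ∀ g : G, Tendsto (fun i => isomToContinuousMap (σ i g)) atTop (𝓝 (isomToContinuousMap (τ g)))

/-! ### Projectivized equivariant distance functions and convergence of based `G`-spaces -/

/-- `d` is a `G`-equivariant pseudometric on `G` that is not identically `0`. -/
structure IsEquivariantDist {G : Type*} [Group G] (d : G → G → ℝ) : Prop where
  nonneg : ∀ a b, 0 ≤ d a b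
  self : ∀ a, d a a = 0
  symm : ∀ a b, d a b = d b a
  triangle : ∀ a b c, d a c ≤ d a b + d b c
  equivariant : ∀ g a b, d (g * a) (g * b) = d a b
  nonzero : ∃ a b, d a b ≠ 0

/-- The space of equivariant distance functions on the discrete group `G`. It has the subspace
topology of the product topology, which is the compact-open topology since `G` is discrete. -/
abbrev EquivDist (G : Type*) [Group G] : Type _ :=
  {d : G → G → ℝ // IsEquivariantDist d}

/-- Two equivariant distance functions are equivalent if they differ by a positive factor. -/
instance equivDistSetoid (G : Type*) [Group G] : Setoid (EquivDist G) where
  r d e := ∃ c : ℝ, 0 < c ∧ ∀ a b, e.1 a b = c * d.1 a b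
  iseqv :=
    { refl := fun d => ⟨1, one_pos, fun a b => (one_mul _).symm⟩
      symm := by
        rintro d e ⟨c, hc, h⟩
        refine ⟨c⁻¹, inv_pos.2 hc, fun a b => ?_⟩
        rw [h, inv_mul_cancel_left₀ hc.ne']
      trans := by
        rintro d e f ⟨c, hc, h⟩ ⟨c', hc', h'⟩
        refine ⟨c' * c, mul_pos hc' hc, fun a b => ?_⟩
        rw [h', h, mul_assoc] }

/-- The space of projectivized equivariant distance functions, with the quotient topology. -/
abbrev ProjEquivDist (G : Type*) [Group G] : Type _ :=
  Quotient (equivDistSetoid G)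

/-- A based `G`-space structure on the metric space `X`: an isometric action together with a
basepoint that is not fixed by the whole group. -/
structure BasedGSpace (G X : Type*) [Group G] [MetricSpace X] where
  action : G →* (X ≃ᵢ X)
  base : X
  base_moved : ∃ g : G, action g base ≠ base

/-- The distance function `d(g, h) = d_X(ρ(g) *, ρ(h) *)` induced by a based `G`-space. -/
noncomputable def BasedGSpace.inducedDist {G X : Type*} [Group G] [MetricSpace X]
    (B : BasedGSpace G X) : EquivDist G :=
  ⟨fun g h => dist (B.action g B.base) (B.action h B.base),
    { nonneg := fun _ _ => dist_nonneg
      self := fun _ => dist_self _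
      symm := fun _ _ => dist_comm _ _
      triangle := fun _ _ _ => dist_triangle _ _ _
      equivariant := fun g a b => by
        simp only [map_mul, IsometryEquiv.mul_apply, IsometryEquiv.dist_eq]
      nonzero := by
        obtain ⟨g, hg⟩ := B.base_moved
        refine ⟨g, 1, ?_⟩
        simpa using hg }⟩

/-- A sequence of based `G`-spaces converges to a based `G`-space if the classes of the induced
distance functions converge in the space of projectivized equivariant distance functions. -/
def BasedGSpace.ConvergesTo {G T : Type*} {X : ℕ → Type*} [Group G] [∀ i, MetricSpace (X i)]
    [MetricSpace T] (A : ∀ i, BasedGSpace G (X i)) (B : BasedGSpace G T) : Prop :=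
  Tendsto (fun i => (Quotient.mk (equivDistSetoid G) (A i).inducedDist : ProjEquivDist G)) atTop
    (𝓝 (Quotient.mk (equivDistSetoid G) B.inducedDist : ProjEquivDist G))

/-! Each `ρ i` has a centrally located point `x i` (`exists_isCentrallyLocated`): if a sublevel set
of the displacement function were unbounded, its points would accumulate at a boundary point, and a
group element that moves them a bounded amount fixes that point. Let `r i` be the minimal
displacement.

If `r i` is bounded along a subsequence, cocompactness allows conjugating so that `x i` lies in a
fixed compact set. Orbits then stay bounded, and an Arzelà–Ascoli argument gives a limit
representation (`exists_subseq_conjRep_convergesCompactOpen`).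

Otherwise `r i → ∞`, and the metrics are divided by `r i`. In the limit along an ultrafilter
(`exists_asymptoticCone`) the hyperbolicity error and the coarse geodesic error both vanish, so the
limit is geodesic and satisfies the four-point condition, hence is a real tree
(`FourPointCondition.isRTree`). A fixed point of the limit action would be represented by points
displaced by `o(r i)`, against the minimality of `r i`.

In both cases ultralimits serve to construct the limit object. Since `G` is countable, the relevant
function spaces on `G` are first countable, so the ultralimit, being a cluster point, is the limit
of an honest subsequence. -/

/-! ### Zero-hyperbolic geodesic spaces are real trees -/

/-- The four-point inequality that characterizes metric subspaces of real trees. -/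
def FourPointCondition (Y : Type*) [PseudoMetricSpace Y] : Prop :=
  ∀ x y z w : Y, dist x y + dist z w ≤ max (dist x z + dist y w) (dist x w + dist y z)

/-- Between any two points there are points at all intermediate distances. -/
def HasIntermediatePoints (Y : Type*) [PseudoMetricSpace Y] : Prop :=
  ∀ x y : Y, ∀ t ∈ Set.Icc (0 : ℝ) (dist x y), ∃ z : Y, dist x z = t ∧ dist z y = dist x y - t

/-- The metric interval between two points. -/
def metricInterval {Y : Type*} [PseudoMetricSpace Y] (x y : Y) : Set Y :=
  {z | dist x z + dist z y = dist x y}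

namespace FourPointCondition

variable {Y : Type*}

theorem dist_le_of_mem_metricInterval [PseudoMetricSpace Y] (h : FourPointCondition Y) {x y z : Y}
    (hz : z ∈ metricInterval x y) (w : Y) :
    dist z w ≤ max (dist x w - dist x z) (dist w y - dist z y) := by
  have h1 := h x y z w
  have hz' : dist x z + dist z y = dist x y := hz
  rw [le_max_iff] at h1 ⊢
  rw [dist_comm y w, dist_comm y z] at h1
  rcases h1 with h1 | h1
  · right; linarith
  · left; linarith

/-- Triangles are tripods. Each alternative in the preceding bound turns one of the triangle
inequalities through `z` into an equality. -/
theorem mem_metricInterval_or [PseudoMetricSpace Y] (h : FourPointCondition Y) {x y z : Y}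
    (hz : z ∈ metricInterval x y) (c : Y) :
    z ∈ metricInterval x c ∨ z ∈ metricInterval c y := by
  have h1 := h.dist_le_of_mem_metricInterval hz c
  have h2 := dist_triangle x z c
  have h3 := dist_triangle c z y
  rw [le_max_iff] at h1
  rw [dist_comm c z] at h3
  simp only [metricInterval, Set.mem_ofPred_eq, dist_comm c z]
  rcases h1 with h1 | h1
  · left; linarith
  · right; linarith

theorem eq_of_mem_metricInterval [MetricSpace Y] (h : FourPointCondition Y) {x y z w : Y}
    (hz : z ∈ metricInterval x y) (hw : w ∈ metricInterval x y) (hd : dist x z = dist x w) :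
    z = w := by
  have h1 := h.dist_le_of_mem_metricInterval hz w
  have hz' : dist x z + dist z y = dist x y := hz
  have hw' : dist x w + dist w y = dist x y := hw
  have h2 : dist w y - dist z y = 0 := by linarith
  rw [hd, sub_self, h2, max_self] at h1
  exact dist_le_zero.1 h1

theorem exists_isometry [MetricSpace Y] (h : FourPointCondition Y) (hI : HasIntermediatePoints Y)
    (x y : Y) : ∃ γ : Set.Icc (0 : ℝ) (dist x y) → Y, Isometry γ ∧
      γ ⟨0, Set.left_mem_Icc.2 dist_nonneg⟩ = x ∧
      γ ⟨dist x y, Set.right_mem_Icc.2 dist_nonneg⟩ = y ∧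
      Set.range γ = metricInterval x y := by
  choose γ h1 h2 using fun t : Set.Icc (0 : ℝ) (dist x y) => hI x y t.1 t.2
  have hmem : ∀ t, γ t ∈ metricInterval x y := fun t => by
    simp only [metricInterval, Set.mem_ofPred_eq, h1, h2]; ring
  refine ⟨γ, Isometry.of_dist_eq fun s t => le_antisymm ?_ ?_, ?_, ?_, ?_⟩
  · have h3 := h.dist_le_of_mem_metricInterval (hmem s) (γ t)
    rw [h1, h1, h2, h2] at h3
    rw [Subtype.dist_eq, Real.dist_eq]
    refine h3.trans (max_le ?_ ?_)
    · rw [abs_sub_comm]; exact le_abs_self _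
    · refine le_trans (le_of_eq ?_) (le_abs_self _); ring
  · rw [Subtype.dist_eq, Real.dist_eq, ← h1 s, ← h1 t]
    simpa only [dist_comm x] using abs_dist_sub_le (γ s) (γ t) x
  · exact (dist_eq_zero.1 (h1 _)).symm
  · refine dist_eq_zero.1 ((h2 _).trans (sub_self _))
  · refine Set.Subset.antisymm (Set.range_subset_iff.2 hmem) fun z hz => ?_
    have hz' : dist x z + dist z y = dist x y := hz
    have hz0 : (0 : ℝ) ≤ dist z y := dist_nonneg
    exact ⟨⟨dist x z, dist_nonneg, by linarith⟩, h.eq_of_mem_metricInterval (hmem _) hz (h1 _)⟩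

/-- A connected set that contains two points contains the metric interval between them: in the
complement of a point `z`, positivity of the Gromov product based at `z` is an open equivalence
relation. -/
theorem metricInterval_subset_of_isPreconnected [MetricSpace Y] (h : FourPointCondition Y)
    {x y : Y} {A : Set Y} (hA : IsPreconnected A) (hx : x ∈ A) (hy : y ∈ A) :
    metricInterval x y ⊆ A := by
  intro z hz
  by_contra hzA
  have hz' : dist x z + dist z y = dist x y := hz
  have hcont : ∀ u : Y, IsOpen {w : Y | dist u w < dist z u + dist z w} := fun u =>
    isOpen_lt (by fun_prop) (by fun_prop)
  have hself : ∀ w ∈ A, dist w w < dist z w + dist z w := fun w hw => by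
    have : 0 < dist z w := dist_pos.2 fun hzw => hzA (hzw ▸ hw)
    rw [dist_self]; linarith
  -- `V` is the union of the classes of points not equivalent to `x`. Since `z` is not in `A`, every
  -- point of `A` is equivalent to itself, so `V` and the class of `x` cover `A`; `y` is in `V`
  -- because `z` lies between `x` and `y`. A common point `w` would contradict transitivity, which
  -- is the four-point condition.
  let V : Set Y := ⋃ u ∈ {u : Y | dist z x + dist z u ≤ dist x u},
    {w : Y | dist u w < dist z u + dist z w}
  obtain ⟨w, -, hw1, hw2⟩ := hA {w | dist x w < dist z x + dist z w} V (hcont x)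
    (isOpen_biUnion fun u _ => hcont u)
    (fun w hw => by
      by_cases hxw : dist x w < dist z x + dist z w
      · exact Or.inl hxw
      · exact Or.inr (Set.mem_biUnion (x := w) (not_lt.1 hxw) (hself w hw)))
    ⟨x, hx, hself x hx⟩
    ⟨y, hy, Set.mem_biUnion (x := y) (by rw [Set.mem_ofPred_eq, dist_comm z x, hz']) (hself y hy)⟩
  obtain ⟨u, hu, huw⟩ := Set.mem_iUnion₂.1 hw2
  have hu' : dist z x + dist z u ≤ dist x u := hu
  have hw1' : dist x w < dist z x + dist z w := hw1
  have huw' : dist u w < dist z u + dist z w := huw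
  have h4 := h x u z w
  rw [le_max_iff, dist_comm x z, dist_comm u z] at h4
  rcases h4 with h4 | h4 <;> linarith

/-- The arc is connected, so it contains the interval. Conversely, the interval is connected, so its
preimage under the embedding is a connected subset of the parameter interval containing both ends,
hence everything. -/
theorem isArc_eq_metricInterval [MetricSpace Y] (h : FourPointCondition Y)
    (hI : HasIntermediatePoints Y) {x y : Y} {A : Set Y} (hA : IsArc A x y) :
    A = metricInterval x y := by
  obtain ⟨a, b, hab, α, hα, hαa, hαb, rfl⟩ := hA
  have : PreconnectedSpace (Set.Icc a b) := Subtype.preconnectedSpace isPreconnected_Icc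
  have hsub : metricInterval x y ⊆ Set.range α :=
    h.metricInterval_subset_of_isPreconnected (isPreconnected_range hα.continuous)
      ⟨_, hαa⟩ ⟨_, hαb⟩
  obtain ⟨γ, hγ, -, -, hr⟩ := h.exists_isometry hI x y
  have : PreconnectedSpace (Set.Icc (0 : ℝ) (dist x y)) :=
    Subtype.preconnectedSpace isPreconnected_Icc
  have hpre : IsPreconnected (α ⁻¹' metricInterval x y) := by
    rw [← hα.isInducing.isPreconnected_image, Set.image_preimage_eq_of_subset hsub, ← hr]
    exact isPreconnected_range hγ.continuous
  refine Set.Subset.antisymm (Set.range_subset_iff.2 fun t => ?_) hsub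
  refine hpre.Icc_subset (a := ⟨a, Set.left_mem_Icc.2 hab⟩) (b := ⟨b, Set.right_mem_Icc.2 hab⟩)
    ?_ ?_ ⟨t.2.1, t.2.2⟩
  · simp [hαa, metricInterval]
  · simp [hαb, metricInterval]

theorem isRTree [MetricSpace Y] (h : FourPointCondition Y) (hI : HasIntermediatePoints Y) :
    IsRTree Y := by
  intro x y
  obtain ⟨γ, hγ, h0, h1, hr⟩ := h.exists_isometry hI x y
  refine ⟨⟨metricInterval x y, ⟨0, dist x y, dist_nonneg, γ, hγ.isEmbedding, h0, h1, hr⟩,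
    fun A hA => h.isArc_eq_metricInterval hI hA⟩, fun A hA => ?_⟩
  rw [h.isArc_eq_metricInterval hI hA]
  exact ⟨0, dist x y, dist_nonneg, γ, hγ, h0, h1, hr⟩

end FourPointCondition

/-! ### The subtree spanned by an orbit -/

/-- The points that lie between two points of the orbit of `p`. -/
def orbitHull {G Y : Type*} [Group G] [MetricSpace Y] (a : G →* (Y ≃ᵢ Y)) (p : Y) : Set Y :=
  ⋃ q : G × G, metricInterval (a q.1 p) (a q.2 p)

theorem FourPointCondition.metricInterval_subset_orbitHull {G Y : Type*} [Group G] [MetricSpace Y]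
    (h : FourPointCondition Y) (a : G →* (Y ≃ᵢ Y)) (p : Y) {x y : Y}
    (hx : x ∈ orbitHull a p) (hy : y ∈ orbitHull a p) : metricInterval x y ⊆ orbitHull a p := by
  -- The case of one endpoint in the orbit. With `x` between `g₁ p` and `g₂ p`, the tripod on `x`,
  -- `g p`, `g₁ p` puts `z` either on the part of that interval from `x` to `g₁ p`, or between two
  -- orbit points. The general case follows by a further tripod with an orbit point as third vertex.
  have aux : ∀ x ∈ orbitHull a p, ∀ g : G, ∀ z ∈ metricInterval x (a g p), z ∈ orbitHull a p := by
    intro x hx g z hz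
    obtain ⟨⟨g₁, g₂⟩, hx'⟩ := Set.mem_iUnion.1 hx
    rcases h.mem_metricInterval_or hz (a g₁ p) with hz' | hz'
    · refine Set.mem_iUnion.2 ⟨(g₁, g₂), ?_⟩
      have e1 : dist (a g₁ p) x + dist x (a g₂ p) = dist (a g₁ p) (a g₂ p) := hx'
      have e2 : dist x z + dist z (a g₁ p) = dist x (a g₁ p) := hz'
      have e3 := dist_triangle z x (a g₂ p)
      have e4 := dist_triangle (a g₁ p) z (a g₂ p)
      rw [dist_comm z (a g₁ p), dist_comm x (a g₁ p)] at e2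
      rw [dist_comm z x] at e3
      exact le_antisymm (by linarith) e4
    · exact Set.mem_iUnion.2 ⟨(g₁, g), hz'⟩
  intro z hz
  obtain ⟨⟨g₁, g₂⟩, -⟩ := Set.mem_iUnion.1 hx
  rcases h.mem_metricInterval_or hz (a g₁ p) with hz' | hz'
  · exact aux x hx g₁ z hz'
  · refine aux y hy g₁ z ?_
    have e : dist (a g₁ p) z + dist z y = dist (a g₁ p) y := hz'
    rw [metricInterval, Set.mem_ofPred_eq, dist_comm y z, dist_comm z (a g₁ p),
      dist_comm y (a g₁ p)]
    linarith

/-- A point of the hull is determined by a pair of group elements and its distance from one end,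
which is data in the universe of `G`. -/
theorem FourPointCondition.small_orbitHull {G : Type u} {Y : Type v} [Group G] [MetricSpace Y]
    (h : FourPointCondition Y) (a : G →* (Y ≃ᵢ Y)) (p : Y) : Small.{u} (orbitHull a p) := by
  choose q hq using fun z : orbitHull a p => Set.mem_iUnion.1 z.2
  refine small_of_injective (β := (G × G) × ℝ) (f := fun z => (q z, dist (a (q z).1 p) z.1)) ?_
  intro z w hzw
  obtain ⟨h1, h2⟩ := Prod.ext_iff.1 hzw
  have hw := hq w
  simp only at h1 h2
  rw [← h1] at hw h2
  exact Subtype.ext (h.eq_of_mem_metricInterval (hq z) hw h2)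

theorem apply_mem_orbitHull {G Y : Type*} [Group G] [MetricSpace Y] (a : G →* (Y ≃ᵢ Y)) (p : Y)
    (g : G) {z : Y} (hz : z ∈ orbitHull a p) : a g z ∈ orbitHull a p := by
  obtain ⟨⟨g₁, g₂⟩, hz⟩ := Set.mem_iUnion.1 hz
  refine Set.mem_iUnion.2 ⟨(g * g₁, g * g₂), ?_⟩
  simpa [metricInterval, IsometryEquiv.dist_eq] using hz

/-- A `G`-space that is a real tree contains an invariant subtree through a given point which is
small enough to live in the universe of `G`. -/
theorem FourPointCondition.exists_basedGSpace {G : Type u} {Y : Type v} [Group G] [MetricSpace Y]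
    (h : FourPointCondition Y) (hI : HasIntermediatePoints Y) (a : G →* (Y ≃ᵢ Y)) (p : Y)
    (hfix : ∀ y : Y, ∃ g : G, a g y ≠ y) :
    ∃ (T : Type u) (_ : MetricSpace T) (B : BasedGSpace G T), IsRTree T ∧
      (∀ g k : G, dist (B.action g B.base) (B.action k B.base) = dist (a g p) (a k p)) ∧
      ∀ t : T, ∃ g : G, B.action g t ≠ t := by
  have := h.small_orbitHull a p
  let ι : Shrink.{u} (orbitHull a p) → Y := fun t => ((equivShrink _).symm t).1
  have hι : Function.Injective ι := Subtype.val_injective.comp (equivShrink _).symm.injective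
  have hsurj : ∀ y ∈ orbitHull a p, ∃ t, ι t = y := fun y hy =>
    ⟨equivShrink _ ⟨y, hy⟩, by simp [ι]⟩
  have hmem : ∀ t, ι t ∈ orbitHull a p := fun t => ((equivShrink _).symm t).2
  let _ : MetricSpace (Shrink.{u} (orbitHull a p)) := MetricSpace.induced ι hι inferInstance
  have hdist : ∀ s t, dist s t = dist (ι s) (ι t) := fun _ _ => rfl
  choose act hact using fun (g : G) (t) => hsurj _ (apply_mem_orbitHull a p g (hmem t))
  let b : G →* (Shrink.{u} (orbitHull a p) ≃ᵢ Shrink.{u} (orbitHull a p)) :=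
    { toFun := fun g => IsometryEquiv.mk' (act g) (act g⁻¹)
        (fun t => hι (by simp [hact, ← IsometryEquiv.mul_apply]))
        (Isometry.of_dist_eq fun s t => by simp [hdist, hact, IsometryEquiv.dist_eq])
      map_one' := IsometryEquiv.ext fun t => hι ((hact 1 t).trans (by simp))
      map_mul' := fun g k => IsometryEquiv.ext fun t => hι <| (hact (g * k) t).trans <| by
        rw [map_mul, IsometryEquiv.mul_apply, ← hact k, ← hact g]; rfl }
  have hb : ∀ g t, ι (b g t) = a g (ι t) := fun g t => hact g t
  obtain ⟨base, hbase⟩ := hsurj p (Set.mem_iUnion.2 ⟨(1, 1), by simp [metricInterval]⟩)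
  have hmoved : ∀ t, ∃ g : G, b g t ≠ t := fun t => by
    obtain ⟨g, hg⟩ := hfix (ι t)
    exact ⟨g, fun e => hg (by rw [← hb, e])⟩
  refine ⟨_, _, ⟨b, base, hmoved base⟩, FourPointCondition.isRTree (fun x y z w => ?_)
    (fun x y t ht => ?_), fun g k => ?_, hmoved⟩
  · simpa only [hdist] using h (ι x) (ι y) (ι z) (ι w)
  · obtain ⟨z, hz1, hz2⟩ := hI (ι x) (ι y) t ht
    obtain ⟨z, rfl⟩ := hsurj z (h.metricInterval_subset_orbitHull a p (hmem x) (hmem y)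
      (by rw [metricInterval, Set.mem_ofPred_eq, hz1, hz2]; ring))
    exact ⟨z, hz1, hz2⟩
  · simp only [hdist, hb, hbase]

/-! ### Hyperbolic spaces -/

/-- In terms of Gromov products the claim bounds `(x·y) + (z·w)` from below with error `2 * δ`. If,
say, `(x·z)` is the largest of the four mixed products, then `(x·y) ≥ (y·z) - δ` and `(z·w) ≥ (x·w)
- δ`. The distances to `o` cancel, and passing to distances doubles the error. -/
theorem IsGromovHyperbolic.four_point {X : Type*} [MetricSpace X] {δ : ℝ} {o : X}
    (hX : IsGromovHyperbolic δ o) (x y z w : X) :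
    dist x y + dist z w ≤ max (dist x z + dist y w) (dist x w + dist y z) + 4 * δ := by
  obtain ⟨-, h⟩ := hX
  have h1 := h x y z
  have h2 := h x y w
  have h3 := h z w x
  have h4 := h z w y
  simp only [gromovProduct, dist_comm z x, dist_comm w x, dist_comm z y, dist_comm w y]
    at h1 h2 h3 h4
  rw [← sub_le_iff_le_add, le_max_iff]
  simp only [sub_le_iff_le_add, min_le_iff] at h1 h2 h3 h4
  by_contra! hcon
  obtain ⟨c1, c2⟩ := hcon
  rcases h1 with h1 | h1 <;> rcases h2 with h2 | h2 <;> rcases h3 with h3 | h3 <;>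
    rcases h4 with h4 | h4 <;> linarith

theorem gromovProduct_sub_dist_le {X : Type*} [MetricSpace X] (o x y z : X) :
    gromovProduct o x y - dist x z ≤ gromovProduct o z y := by
  simp only [gromovProduct]
  have h1 := dist_triangle o z x
  have h2 := dist_triangle z x y
  rw [dist_comm z x] at h1 h2
  linarith

/-- In a proper coarsely geodesic hyperbolic space, every unbounded sequence has a subsequence
that converges to a point at infinity. -/
theorem exists_asymptoticAtInfinity {X : Type*} [MetricSpace X] [ProperSpace X] {δ : ℝ} {o : X}
    (hX : IsGromovHyperbolic δ o) (hgeod : IsCoarselyGeodesic X) (y : ℕ → X)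
    (hy : ∀ n : ℕ, (n : ℝ) ≤ dist o (y n)) :
    ∃ k : ℕ → ℕ, AsymptoticAtInfinity o (y ∘ k) (y ∘ k) := by
  obtain ⟨C, hC⟩ := hgeod
  -- `z R n` is a point about `R` along the way from `o` to `y n`; for `n < R` its value is
  -- irrelevant.
  have hz : ∀ R n : ℕ, ∃ z : X, R ≤ n → |dist o z - R| ≤ C ∧
      |dist z (y n) - (dist o (y n) - R)| ≤ C := fun R n => by
    by_cases hRn : R ≤ n
    · obtain ⟨z, hz⟩ := hC o (y n) R
        ⟨R.cast_nonneg, le_trans (Nat.cast_le.2 hRn) (hy n)⟩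
      exact ⟨z, fun _ => hz⟩
    · exact ⟨o, fun hh => absurd hh hRn⟩
  choose z hz using hz
  let U : Ultrafilter ℕ := hyperfilter ℕ
  have hU : ∀ R : ℕ, ∀ᶠ n in (U : Filter ℕ), R ≤ n := fun R =>
    (Nat.hyperfilter_le_atTop) (eventually_ge_atTop R)
  have hlim : ∀ R : ℕ, ∃ ζ : X, Tendsto (z R) U (𝓝 ζ) := fun R => by
    obtain ⟨ζ, -, hζ⟩ := (isCompact_closedBall o (R + C)).ultrafilter_le_nhds' (U.map (z R)) <| by
      rw [Ultrafilter.mem_map]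
      filter_upwards [hU R] with n hn
      have := (abs_le.1 (hz R n hn).1).2
      rw [Set.mem_preimage, Metric.mem_closedBall, dist_comm]
      linarith
    exact ⟨ζ, hζ⟩
  choose ζ hζ using hlim
  have hev : ∀ R : ℕ, ∀ᶠ n in (U : Filter ℕ), R ≤ n ∧ dist (z R n) (ζ R) < 1 := fun R =>
    (hU R).and ((hζ R).eventually (Metric.ball_mem_nhds _ one_pos))
  -- This replaces a diagonal argument: `y (k m)` is reached through points close to `ζ R` for all
  -- `R ≤ m` at once. Hence its Gromov product with `ζ R` is at least about `R`, and hyperbolicity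
  -- through `ζ R` compares any two late terms.
  have hk : ∀ m : ℕ, ∃ n : ℕ, ∀ R ∈ Set.Iic m, R ≤ n ∧ dist (z R n) (ζ R) < 1 := fun m =>
    (((Set.finite_Iic m).eventually_all).2 fun R _ => hev R).exists
  choose k hk using hk
  refine ⟨k, tendsto_atTop.2 fun b => ?_⟩
  obtain ⟨R, hR⟩ := exists_nat_ge (b + C + 2 + 2 * δ)
  have hδ := hX.1
  have hyz : ∀ m ≥ R, (R : ℝ) - C - 2 ≤ gromovProduct o (y (k m)) (ζ R) := fun m hm => by
    obtain ⟨h1, h2⟩ := hk m R hm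
    obtain ⟨h3, h4⟩ := hz R _ h1
    have h3' := (abs_le.1 h3).1
    have h4' := (abs_le.1 h4).2
    have h5 := dist_triangle (y (k m)) (z R (k m)) (ζ R)
    have h6 := dist_triangle o (ζ R) (z R (k m))
    rw [dist_comm (ζ R)] at h6
    rw [dist_comm (y (k m)) (z R (k m))] at h5
    simp only [gromovProduct]
    linarith
  filter_upwards [eventually_ge_atTop (R, R)] with p hp
  have h := hX.2 (y (k p.1)) (y (k p.2)) (ζ R)
  have h' := le_min (hyz p.1 hp.1) (hyz p.2 hp.2)
  simp only [Function.comp_apply]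
  linarith

/-! ### Displacement functions -/

section Displacement

variable {G X : Type*} [Group G] [MetricSpace X]

theorem dist_le_maxDisplacement {S : Finset G} (ρ : G →* (X ≃ᵢ X)) (x : X) {g : G} (hg : g ∈ S) :
    dist x (ρ g x) ≤ maxDisplacement S ρ x := by
  rw [← coe_nndist, NNReal.coe_le_coe]
  exact Finset.le_sup (f := fun g => nndist x (ρ g x)) hg

theorem continuous_maxDisplacement (S : Finset G) (ρ : G →* (X ≃ᵢ X)) :
    Continuous (maxDisplacement S ρ) :=
  Continuous.finset_sup_apply fun g _ => continuous_id.nndist (ρ g).continuous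

/-- The displacement of a group element is bounded by its word length times the displacement of
the generators. -/
theorem exists_dist_le_mul_maxDisplacement {S : Finset G}
    (hS : Subgroup.closure (S : Set G) = ⊤) (g : G) :
    ∃ N : ℝ, 0 ≤ N ∧ ∀ (ρ : G →* (X ≃ᵢ X)) (x : X), dist x (ρ g x) ≤ N * maxDisplacement S ρ x := by
  have hg : g ∈ Subgroup.closure (S : Set G) := hS ▸ Subgroup.mem_top g
  induction hg using Subgroup.closure_induction with
  | mem g hg => exact ⟨1, zero_le_one, fun ρ x => by simpa using dist_le_maxDisplacement ρ x hg⟩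
  | one => exact ⟨0, le_rfl, fun ρ x => by simp⟩
  | mul g k _ _ hg hk =>
    obtain ⟨N, hN0, hN⟩ := hg
    obtain ⟨M, hM0, hM⟩ := hk
    refine ⟨N + M, add_nonneg hN0 hM0, fun ρ x => ?_⟩
    have h1 := dist_triangle x (ρ g x) (ρ (g * k) x)
    rw [map_mul, IsometryEquiv.mul_apply, IsometryEquiv.dist_eq] at h1
    rw [map_mul, IsometryEquiv.mul_apply, add_mul]
    linarith [hN ρ x, hM ρ x]
  | inv g _ hg =>
    obtain ⟨N, hN0, hN⟩ := hg
    refine ⟨N, hN0, fun ρ x => ?_⟩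
    have h1 := hN ρ x
    rwa [← (ρ g⁻¹).dist_eq, ← IsometryEquiv.mul_apply, ← map_mul, inv_mul_cancel, map_one,
      IsometryEquiv.coe_one, id, dist_comm] at h1

/-- A bounded sublevel set is compact by properness, and the minimum is attained there. In an
unbounded one, a sequence escapes to a boundary point while each group element moves its terms by a
bounded amount, so that point is fixed. -/
theorem exists_isCentrallyLocated [ProperSpace X] {δ : ℝ} {o : X}
    (hX : IsGromovHyperbolic δ o) (hgeod : IsCoarselyGeodesic X) {S : Finset G}
    (hS : Subgroup.closure (S : Set G) = ⊤) {ρ : G →* (X ≃ᵢ X)} (hρ : IsNonElementary o ρ) :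
    ∃ x : X, IsCentrallyLocated S ρ x := by
  let L : Set X := {x | maxDisplacement S ρ x ≤ maxDisplacement S ρ o}
  have hclosed : IsClosed L := isClosed_le (continuous_maxDisplacement S ρ) continuous_const
  by_cases hb : Bornology.IsBounded L
  · obtain ⟨x, hx, hmin⟩ := (Metric.isCompact_of_isClosed_isBounded hclosed hb).exists_isMinOn
      ⟨o, le_refl (maxDisplacement S ρ o)⟩ (continuous_maxDisplacement S ρ).continuousOn
    refine ⟨x, fun y => ?_⟩
    by_cases hy : y ∈ L
    · exact hmin hy
    · exact le_trans hx (not_le.1 hy).le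
  · exfalso
    have hunb : ∀ n : ℕ, ∃ y ∈ L, (n : ℝ) ≤ dist o y := fun n => by
      by_contra! hcon
      refine hb ((Metric.isBounded_iff_subset_closedBall o).2 ⟨n, fun y hy => ?_⟩)
      rw [Metric.mem_closedBall, dist_comm]
      exact (hcon y hy).le
    choose y hyL hy using hunb
    obtain ⟨k, hk⟩ := exists_asymptoticAtInfinity hX hgeod y hy
    refine hρ ⟨y ∘ k, hk, fun g => ?_⟩
    obtain ⟨N, hN0, hN⟩ := exists_dist_le_mul_maxDisplacement (X := X) hS g
    refine tendsto_atTop_mono (fun p => ?_)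
      (tendsto_atTop_add_const_right _ (-(N * maxDisplacement S ρ o)) hk)
    have h1 := gromovProduct_sub_dist_le o (y (k p.1)) (y (k p.2)) (ρ g (y (k p.1)))
    have h2 := hN ρ (y (k p.1))
    have h3 : N * maxDisplacement S ρ (y (k p.1)) ≤ N * maxDisplacement S ρ o :=
      mul_le_mul_of_nonneg_left (NNReal.coe_le_coe.2 (hyL _)) hN0
    simp only [Function.comp_apply]
    linarith

end Displacement

/-! ### Limits of representations with bounded displacement -/

/-- Isometries are equicontinuous, so pointwise convergence is locally uniform. -/
theorem tendsto_isomToContinuousMap {ι X : Type*} [MetricSpace X] {l : Filter ι}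
    {f : ι → (X ≃ᵢ X)} {F : X ≃ᵢ X} (h : ∀ x, Tendsto (fun i => f i x) l (𝓝 (F x))) :
    Tendsto (fun i => isomToContinuousMap (f i)) l (𝓝 (isomToContinuousMap F)) := by
  refine ContinuousMap.tendsto_of_tendstoLocallyUniformly
    (Metric.tendstoLocallyUniformly_iff.2 fun ε hε x => ?_)
  refine ⟨Metric.ball x (ε / 3), Metric.ball_mem_nhds x (by positivity), ?_⟩
  filter_upwards [Metric.tendsto_nhds.1 (h x) (ε / 3) (by positivity)] with i hi y hy
  change dist (F y) (f i y) < ε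
  have h1 := dist_triangle4 (F y) (F x) (f i x) (f i y)
  rw [F.dist_eq, (f i).dist_eq, dist_comm (F x), dist_comm x y] at h1
  rw [Metric.mem_ball] at hy
  linarith

theorem exists_subseq_convergesCompactOpen {G X : Type*} [Group G] [Countable G] [MetricSpace X]
    [ProperSpace X] (σ : ℕ → G →* (X ≃ᵢ X)) (o : X)
    (hσ : ∀ g : G, ∃ N : ℝ, ∀ i, dist o (σ i g o) ≤ N) :
    ∃ (k : ℕ → ℕ) (τ : G →* (X ≃ᵢ X)), StrictMono k ∧
      ConvergesCompactOpen (fun i => σ (k i)) τ := by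
  let U : Ultrafilter ℕ := hyperfilter ℕ
  have hlim : ∀ (g : G) (x : X), ∃ y : X, Tendsto (fun i => σ i g x) U (𝓝 y) := fun g x => by
    obtain ⟨N, hN⟩ := hσ g
    obtain ⟨y, -, hy⟩ := (isCompact_closedBall o (N + dist o x)).ultrafilter_le_nhds'
      (U.map fun i => σ i g x) <| by
        refine Ultrafilter.mem_map.2 (Eventually.of_forall fun i => ?_)
        have h1 := dist_triangle o (σ i g o) (σ i g x)
        rw [(σ i g).dist_eq] at h1
        rw [Metric.mem_closedBall, dist_comm]
        linarith [hN i]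
    exact ⟨y, hy⟩
  choose t ht using hlim
  have hdist : ∀ g x y, dist (t g x) (t g y) = dist x y := fun g x y =>
    tendsto_nhds_unique ((ht g x).dist (ht g y)) (by simp [IsometryEquiv.dist_eq])
  have hone : ∀ x, t 1 x = x := fun x => tendsto_nhds_unique (ht 1 x) (by simp)
  have hmul : ∀ g k x, t (g * k) x = t g (t k x) := fun g k x => by
    refine dist_eq_zero.1 (tendsto_nhds_unique ((ht (g * k) x).dist (ht g (t k x))) ?_)
    simpa [IsometryEquiv.dist_eq] using tendsto_iff_dist_tendsto_zero.1 (ht k x)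
  let τ : G →* (X ≃ᵢ X) :=
    { toFun := fun g => IsometryEquiv.mk' (t g) (t g⁻¹)
        (fun x => by rw [← hmul, mul_inv_cancel, hone]) (Isometry.of_dist_eq (hdist g))
      map_one' := IsometryEquiv.ext hone
      map_mul' := fun g k => IsometryEquiv.ext (hmul g k) }
  have hτ : Tendsto (fun i => fun g => isomToContinuousMap (σ i g)) U
      (𝓝 fun g => isomToContinuousMap (τ g)) :=
    tendsto_pi_nhds.2 fun g => tendsto_isomToContinuousMap (ht g)
  -- The countable product of copies of `C(X, X)` is first countable, so one subsequence serves all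
  -- `g` at once.
  obtain ⟨k, hk, hkτ⟩ := (hτ.mapClusterPt.mono Nat.hyperfilter_le_atTop).tendsto_subseq
  exact ⟨k, τ, hk, fun g => (tendsto_pi_nhds.1 hkτ) g⟩

theorem countable_of_closure_eq_top {G : Type*} [Group G] {S : Finset G}
    (hS : Subgroup.closure (S : Set G) = ⊤) : Countable G := by
  rw [FreeGroup.closure_eq_range, MonoidHom.range_eq_top] at hS
  exact (hS.comp Quot.mk_surjective).countable

theorem exists_subseq_conjRep_convergesCompactOpen {G X : Type*} [Group G] [MetricSpace X]
    [ProperSpace X] (hcocompact : IsomActsCocompactly X) {S : Finset G}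
    (hS : Subgroup.closure (S : Set G) = ⊤) (ρ : ℕ → G →* (X ≃ᵢ X)) (x : ℕ → X) (M : ℝ)
    (hM : ∀ i, (maxDisplacement S (ρ i) (x i) : ℝ) ≤ M) :
    ∃ (k : ℕ → ℕ) (φ : ℕ → (X ≃ᵢ X)) (τ : G →* (X ≃ᵢ X)), StrictMono k ∧
      ConvergesCompactOpen (fun i => conjRep (ρ (k i)) (φ i)) τ := by
  have : Countable G := countable_of_closure_eq_top hS
  obtain ⟨K, hK, hcover⟩ := hcocompact
  have hex : ∀ i, ∃ φ : X ≃ᵢ X, φ (x i) ∈ K := fun i => by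
    obtain ⟨φ, p, hp, hφ⟩ := Set.mem_iUnion.1 (hcover.symm ▸ Set.mem_univ (x i))
    exact ⟨φ.symm, by rwa [← hφ, IsometryEquiv.symm_apply_apply]⟩
  choose φ hφ using hex
  obtain ⟨D, hD⟩ := hK.isBounded.subset_closedBall (x 0)
  obtain ⟨k, τ, hk, hτ⟩ := exists_subseq_convergesCompactOpen
    (fun i => conjRep (ρ i) (φ i)) (x 0) fun g => by
      obtain ⟨N, hN0, hN⟩ := exists_dist_le_mul_maxDisplacement (X := X) hS g
      -- Travel from `x 0` to `φ i (x i)` in `K`, apply the conjugated element there, and return by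
      -- the isometric image of the first leg.
      refine ⟨D + N * M + D, fun i => ?_⟩
      have h0 : conjRep (ρ i) (φ i) g (φ i (x i)) = φ i (ρ i g (x i)) := by
        simp [conjRep]
      have h1 := dist_triangle4 (x 0) (φ i (x i)) (conjRep (ρ i) (φ i) g (φ i (x i)))
        (conjRep (ρ i) (φ i) g (x 0))
      rw [IsometryEquiv.dist_eq, h0, IsometryEquiv.dist_eq, dist_comm (x 0) (φ i (x i))] at h1
      have h2 := hD (hφ i)
      rw [Metric.mem_closedBall] at h2
      linarith [hN (ρ i) (x i), mul_le_mul_of_nonneg_left (hM i) hN0]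
  exact ⟨k, fun i => φ (k i), τ, hk, hτ⟩

/-! ### Asymptotic cones -/

/-- The sequences of points at distance `O(r i)` from the basepoints `x i`. -/
def ConePoint {X : Type*} [MetricSpace X] (x : ℕ → X) (r : ℕ → ℝ) : Type _ :=
  {z : ℕ → X // ∃ C : ℝ, ∀ i, dist (x i) (z i) ≤ C * r i}

/-- The limit along `U` of the distances rescaled by `1 / r i`. -/
noncomputable def coneDist {X : Type*} [MetricSpace X] {x : ℕ → X} {r : ℕ → ℝ}
    (U : Ultrafilter ℕ) (z w : ConePoint x r) : ℝ :=
  limUnder (U : Filter ℕ) fun i => dist (z.1 i) (w.1 i) / r i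

/-- The rescaled distances stay in a compact interval, so they converge along any ultrafilter. -/
theorem tendsto_coneDist {X : Type*} [MetricSpace X] {x : ℕ → X} {r : ℕ → ℝ} (hr : ∀ i, 1 ≤ r i)
    (U : Ultrafilter ℕ) (z w : ConePoint x r) :
    Tendsto (fun i => dist (z.1 i) (w.1 i) / r i) U (𝓝 (coneDist U z w)) := by
  refine tendsto_nhds_limUnder ?_
  obtain ⟨C, hC⟩ := z.2
  obtain ⟨D, hD⟩ := w.2
  obtain ⟨y, -, hy⟩ := (isCompact_Icc (a := (0 : ℝ)) (b := C + D)).ultrafilter_le_nhds'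
    (U.map fun i => dist (z.1 i) (w.1 i) / r i) <| by
      refine Ultrafilter.mem_map.2 (Eventually.of_forall fun i => ?_)
      have hri : 0 < r i := zero_lt_one.trans_le (hr i)
      refine ⟨by positivity, (div_le_iff₀ hri).2 ?_⟩
      have h1 := dist_triangle (z.1 i) (x i) (w.1 i)
      rw [dist_comm (z.1 i) (x i)] at h1
      linarith [hC i, hD i]
  exact ⟨y, hy⟩

/-- The pseudometric on the sequences of points that gives rise to the asymptotic cone. -/
noncomputable abbrev conePseudoMetricSpace {X : Type*} [MetricSpace X] {x : ℕ → X} {r : ℕ → ℝ}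
    (hr : ∀ i, 1 ≤ r i) (U : Ultrafilter ℕ) : PseudoMetricSpace (ConePoint x r) where
  dist := coneDist U
  dist_self z := tendsto_nhds_unique (tendsto_coneDist hr U z z) (by simp)
  dist_comm z w := tendsto_nhds_unique (tendsto_coneDist hr U z w)
    (by simpa only [dist_comm] using tendsto_coneDist hr U w z)
  dist_triangle z w u := le_of_tendsto_of_tendsto' (tendsto_coneDist hr U z u)
    ((tendsto_coneDist hr U z w).add (tendsto_coneDist hr U w u)) fun i => by
      have hri : 0 < r i := zero_lt_one.trans_le (hr i)
      rw [← add_div]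
      gcongr
      exact dist_triangle _ _ _

/-- The action on the asymptotic cone: `Y` is the space of sequences of points of `X` modulo
sequences at sublinear distance. -/
theorem exists_asymptoticCone {G : Type u} {X : Type v} [Group G] [MetricSpace X] {δ : ℝ} {o : X}
    (hX : IsGromovHyperbolic δ o) (hgeod : IsCoarselyGeodesic X) (U : Ultrafilter ℕ)
    (ρ : ℕ → G →* (X ≃ᵢ X)) (x : ℕ → X) {r : ℕ → ℝ} (hr : ∀ i, 1 ≤ r i) (hrU : Tendsto r U atTop)
    (hρ : ∀ g : G, ∃ C : ℝ, ∀ i, dist (x i) (ρ i g (x i)) ≤ C * r i) :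
    ∃ (Y : Type v) (_ : MetricSpace Y) (a : G →* (Y ≃ᵢ Y)) (p : Y),
      FourPointCondition Y ∧ HasIntermediatePoints Y ∧
      (∀ g k : G, Tendsto (fun i => dist (ρ i g (x i)) (ρ i k (x i)) / r i) U
        (𝓝 (dist (a g p) (a k p)))) ∧
      ∀ y : Y, ∃ z : ℕ → X, ∀ g : G, Tendsto (fun i => dist (z i) (ρ i g (z i)) / r i) U
        (𝓝 (dist y (a g y))) := by
  have hr0 : ∀ i, 0 < r i := fun i => zero_lt_one.trans_le (hr i)
  let _ : PseudoMetricSpace (ConePoint x r) := conePseudoMetricSpace hr U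
  let π : ConePoint x r → SeparationQuotient (ConePoint x r) := SeparationQuotient.mk
  have hπ : ∀ z w, Tendsto (fun i => dist (z.1 i) (w.1 i) / r i) U (𝓝 (dist (π z) (π w))) :=
    tendsto_coneDist hr U
  have hsurj : ∀ y, ∃ z, π z = y := SeparationQuotient.surjective_mk
  let act : G → ConePoint x r → ConePoint x r := fun g z => ⟨fun i => ρ i g (z.1 i), by
    obtain ⟨C, hC⟩ := hρ g
    obtain ⟨D, hD⟩ := z.2
    refine ⟨C + D, fun i => ?_⟩
    have h1 := dist_triangle (x i) (ρ i g (x i)) (ρ i g (z.1 i))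
    rw [IsometryEquiv.dist_eq] at h1
    linarith [hC i, hD i]⟩
  have hact : ∀ g z w, dist (π (act g z)) (π (act g w)) = dist (π z) (π w) := fun g z w =>
    tendsto_nhds_unique (hπ _ _) (by simpa only [act, IsometryEquiv.dist_eq] using hπ z w)
  -- The action on the quotient is defined through representatives; `hact` makes it independent of
  -- their choice.
  choose l hl using hsurj
  have hactl : ∀ g z, π (act g (l (π z))) = π (act g z) := fun g z => by
    rw [← dist_eq_zero, hact, hl, dist_self]
  have hmul : ∀ g k y, π (act (g * k) (l y)) = π (act g (l (π (act k (l y))))) := fun g k y => by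
    rw [hactl]
    simp [act]
  have hone : ∀ y, π (act 1 (l y)) = y := fun y => by
    have h1 : act 1 (l y) = l y := Subtype.ext (funext fun i => by simp [act])
    rw [h1, hl]
  let a : G →* (SeparationQuotient (ConePoint x r) ≃ᵢ SeparationQuotient (ConePoint x r)) :=
    { toFun := fun g => IsometryEquiv.mk' (fun y => π (act g (l y))) (fun y => π (act g⁻¹ (l y)))
        (fun y => by rw [← hmul, mul_inv_cancel, hone])
        (Isometry.of_dist_eq fun y y' => by rw [hact, hl, hl])
      map_one' := IsometryEquiv.ext hone
      map_mul' := fun g k => IsometryEquiv.ext (hmul g k) }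
  have ha : ∀ g z, a g (π z) = π (act g z) := hactl
  let b : ConePoint x r := ⟨x, 0, fun i => by simp⟩
  refine ⟨_, inferInstance, a, π b, ?_, ?_, fun g k => ?_, fun y => ?_⟩
  · intro y₁ y₂ y₃ y₄
    rw [← hl y₁, ← hl y₂, ← hl y₃, ← hl y₄]
    have h0 : Tendsto (fun i => 4 * δ / r i) U (𝓝 0) := tendsto_const_nhds.div_atTop hrU
    have hlim := (((hπ (l y₁) (l y₃)).add (hπ (l y₂) (l y₄))).max
      ((hπ (l y₁) (l y₄)).add (hπ (l y₂) (l y₃)))).add h0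
    rw [add_zero] at hlim
    refine le_of_tendsto_of_tendsto' ((hπ _ _).add (hπ _ _)) hlim fun i => ?_
    simp only [← add_div]
    rw [max_div_div_right (hr0 i).le, ← add_div]
    exact div_le_div_of_nonneg_right (hX.four_point _ _ _ _) (hr0 i).le
  · intro y₁ y₂ t ht
    obtain ⟨C, hC⟩ := hgeod
    obtain ⟨z, rfl⟩ : ∃ z, π z = y₁ := ⟨_, hl y₁⟩
    obtain ⟨w, rfl⟩ : ∃ w, π w = y₂ := ⟨_, hl y₂⟩
    -- The bound on `t` holds only in the limit, so `t * r i` may exceed the distance at finite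
    -- stages and is truncated; the truncation disappears after rescaling.
    choose u hu1 hu2 using fun i => hC (z.1 i) (w.1 i) (min (t * r i) (dist (z.1 i) (w.1 i)))
      ⟨le_min (mul_nonneg ht.1 (hr0 i).le) dist_nonneg, min_le_right _ _⟩
    have hC0 : 0 ≤ C := (abs_nonneg _).trans (hu1 0)
    have hu : ∃ D : ℝ, ∀ i, dist (x i) (u i) ≤ D * r i := by
      obtain ⟨D, hD⟩ := z.2
      refine ⟨D + t + C, fun i => ?_⟩
      have h1 := dist_triangle (x i) (z.1 i) (u i)
      have h2 := (abs_le.1 (hu1 i)).2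
      have h3 := min_le_left (t * r i) (dist (z.1 i) (w.1 i))
      have h4 := mul_le_mul_of_nonneg_left (hr i) hC0
      linarith [hD i]
    have hmin : Tendsto (fun i => min (t * r i) (dist (z.1 i) (w.1 i)) / r i) U (𝓝 t) := by
      have h1 := (tendsto_const_nhds (x := t)).min (hπ z w)
      rw [min_eq_left ht.2] at h1
      refine h1.congr fun i => ?_
      rw [← min_div_div_right (hr0 i).le, mul_div_cancel_right₀ _ (hr0 i).ne']
    have hclose : ∀ f f' : ℕ → ℝ, ∀ c : ℝ, (∀ i, |f i - f' i| ≤ C) →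
        Tendsto (fun i => f' i / r i) U (𝓝 c) → Tendsto (fun i => f i / r i) U (𝓝 c) := by
      intro f f' c hff' hf'
      refine tendsto_of_tendsto_of_dist hf' (squeeze_zero (fun _ => dist_nonneg) (fun i => ?_)
        (tendsto_const_nhds.div_atTop hrU : Tendsto (fun i => C / r i) U (𝓝 0)))
      rw [dist_comm, Real.dist_eq, ← sub_div, abs_div, abs_of_pos (hr0 i)]
      exact div_le_div_of_nonneg_right (hff' i) (hr0 i).le
    refine ⟨π ⟨u, hu⟩, tendsto_nhds_unique (hπ _ _) (hclose _ _ _ hu1 hmin),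
      tendsto_nhds_unique (hπ _ _) (hclose _ _ _ hu2 ?_)⟩
    simpa only [sub_div] using (hπ z w).sub hmin
  · rw [ha, ha]
    exact hπ _ _
  · refine ⟨(l y).1, fun g => ?_⟩
    have h1 := hπ (l y) (act g (l y))
    rwa [← ha, hl] at h1

/-! ### Convergence of based `G`-spaces -/

/-- Rescaling does not change the projective class, and the quotient map is continuous. -/
theorem BasedGSpace.convergesTo_of_tendsto_div {G T : Type*} {X : ℕ → Type*} [Group G]
    [∀ i, MetricSpace (X i)] [MetricSpace T] (A : ∀ i, BasedGSpace G (X i)) (B : BasedGSpace G T)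
    (r : ℕ → ℝ) (hr : ∀ i, 0 < r i)
    (h : Tendsto (fun i g k => (A i).inducedDist.1 g k / r i) atTop (𝓝 B.inducedDist.1)) :
    BasedGSpace.ConvergesTo A B := by
  let e : ℕ → EquivDist G := fun i => ⟨fun g k => (A i).inducedDist.1 g k / r i,
    { nonneg := fun a b => div_nonneg ((A i).inducedDist.2.nonneg a b) (hr i).le
      self := fun a => by rw [(A i).inducedDist.2.self, zero_div]
      symm := fun a b => by rw [(A i).inducedDist.2.symm]
      triangle := fun a b c => by
        rw [← add_div]
        exact div_le_div_of_nonneg_right ((A i).inducedDist.2.triangle a b c) (hr i).le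
      equivariant := fun g a b => by rw [(A i).inducedDist.2.equivariant]
      nonzero := by
        obtain ⟨a, b, hab⟩ := (A i).inducedDist.2.nonzero
        exact ⟨a, b, div_ne_zero hab (hr i).ne'⟩ }⟩
  have he : Tendsto e atTop (𝓝 B.inducedDist) := tendsto_subtype_rng.2 h
  have hcont : Continuous (Quotient.mk (equivDistSetoid G)) := continuous_quot_mk
  refine ((hcont.tendsto _).comp he).congr fun i => Quotient.sound ⟨r i, hr i, fun a b => ?_⟩
  exact (mul_div_cancel₀ _ (hr i).ne').symm

/-- If the minimal displacements go to infinity, then the rescaled based spaces subconverge to a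
real tree without global fixed point. -/
theorem exists_subseq_convergesTo_rTree {G : Type u} {X : Type v} [Group G] [MetricSpace X]
    {δ : ℝ} {o : X} (hX : IsGromovHyperbolic δ o) (hgeod : IsCoarselyGeodesic X)
    {S : Finset G} (hS : Subgroup.closure (S : Set G) = ⊤)
    (A : ℕ → BasedGSpace G X) (hA : ∀ i, IsCentrallyLocated S (A i).action (A i).base)
    (hgrow : ∀ i : ℕ, (i : ℝ) + 1 ≤ maxDisplacement S (A i).action (A i).base) :
    ∃ k : ℕ → ℕ, StrictMono k ∧ ∃ (T : Type u) (_ : MetricSpace T) (B : BasedGSpace G T),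
      IsRTree T ∧ BasedGSpace.ConvergesTo (fun i => A (k i)) B ∧
      ∀ t : T, ∃ g : G, B.action g t ≠ t := by
  have : Countable G := countable_of_closure_eq_top hS
  let U : Ultrafilter ℕ := hyperfilter ℕ
  let r : ℕ → ℝ := fun i => maxDisplacement S (A i).action (A i).base
  have hr : ∀ i, 1 ≤ r i := fun i => le_trans (by simp) (hgrow i)
  have hr0 : ∀ i, 0 < r i := fun i => zero_lt_one.trans_le (hr i)
  have hratop : Tendsto r atTop atTop := tendsto_atTop_mono hgrow
    (tendsto_atTop_add_const_right _ _ tendsto_natCast_atTop_atTop)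
  obtain ⟨Y, _, a, p, h4, hI, hlim, hrep⟩ := exists_asymptoticCone hX hgeod U
    (fun i => (A i).action) (fun i => (A i).base) hr (hratop.mono_left Nat.hyperfilter_le_atTop)
    fun g => by
      obtain ⟨N, -, hN⟩ := exists_dist_le_mul_maxDisplacement (X := X) hS g
      exact ⟨N, fun i => hN _ _⟩
  have hfix : ∀ y : Y, ∃ g : G, a g y ≠ y := by
    intro y
    by_contra! hy
    obtain ⟨z, hz⟩ := hrep y
    -- A fixed point `y` is represented by points `z i` with displacement `o(r i)` under each
    -- generator. As `S` is finite, some `z i` is displaced by less than `r i` by all of them,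
    -- contradicting centrality of the basepoint.
    have hsmall : ∀ g ∈ S, ∀ᶠ i in (U : Filter ℕ), dist (z i) ((A i).action g (z i)) / r i < 1 :=
      fun g _ => by
        have h1 := hz g
        rw [hy, dist_self] at h1
        exact h1.eventually_lt_const one_pos
    obtain ⟨i, hi⟩ := ((Finset.eventually_all S).2 hsmall).exists
    refine (hA i (z i)).not_gt ((Finset.sup_lt_iff ?_).2 fun g hg => ?_)
    -- Positivity covers an empty `S`, whose supremum is `0`.
    · exact NNReal.coe_pos.1 (hr0 i)
    · rw [← NNReal.coe_lt_coe, coe_nndist]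
      exact (div_lt_one (hr0 i)).1 (hi g hg)
  obtain ⟨T, _, B, hT, hB, hBfix⟩ := h4.exists_basedGSpace hI a p hfix
  have hBU : Tendsto (fun i g k => (A i).inducedDist.1 g k / r i) U (𝓝 B.inducedDist.1) := by
    refine tendsto_pi_nhds.2 fun g => tendsto_pi_nhds.2 fun k => ?_
    have h1 := hlim g k
    rw [← hB] at h1
    exact h1
  obtain ⟨k, hk, hkB⟩ := (hBU.mapClusterPt.mono Nat.hyperfilter_le_atTop).tendsto_subseq
  exact ⟨k, hk, T, _, B, hT,
    BasedGSpace.convergesTo_of_tendsto_div _ _ (fun i => r (k i)) (fun i => hr0 _) hkB, hBfix⟩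

theorem mainTheorem4 {G : Type u} [Group G] {X : Type v} [MetricSpace X] [ProperSpace X]
    (δ : ℝ) (o : X) (hX : IsGromovHyperbolic δ o) (hgeod : IsCoarselyGeodesic X)
    (hcocompact : IsomActsCocompactly X)
    (S : Finset G) (hS : Subgroup.closure (S : Set G) = ⊤)
    (ρ : ℕ → G →* (X ≃ᵢ X)) (hρ : ∀ i, IsNonElementary o (ρ i)) :
    ∃ k : ℕ → ℕ, StrictMono k ∧
      ((∃ (φ : ℕ → (X ≃ᵢ X)) (τ : G →* (X ≃ᵢ X)),
          ConvergesCompactOpen (fun i => conjRep (ρ (k i)) (φ i)) τ) ∨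
        (∃ (x : ℕ → X) (hx : ∀ i, ∃ g : G, ρ (k i) g (x i) ≠ x i),
          (∀ i, IsCentrallyLocated S (ρ (k i)) (x i)) ∧
          ∃ (T : Type u) (_ : MetricSpace T) (B : BasedGSpace G T),
            IsRTree T ∧
            BasedGSpace.ConvergesTo (X := fun _ => X)
              (fun i => ⟨ρ (k i), x i, hx i⟩) B ∧
            ∀ t : T, ∃ g : G, B.action g t ≠ t)) := by
  choose x hx using fun i => exists_isCentrallyLocated hX hgeod hS (hρ i)
  -- Either the minimal displacements are bounded along a subsequence, or they tend to infinity. In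
  -- the latter case the subsequence is chosen with displacement at least `i + 1`, so the scaling
  -- factors are at least `1` and no basepoint is globally fixed.
  by_cases hM : ∃ M : ℝ, ∃ᶠ i in atTop, (maxDisplacement S (ρ i) (x i) : ℝ) ≤ M
  · obtain ⟨M, hM⟩ := hM
    obtain ⟨j, hj, hjM⟩ := extraction_of_frequently_atTop hM
    obtain ⟨k, φ, τ, hk, hτ⟩ := exists_subseq_conjRep_convergesCompactOpen hcocompact hS
      (fun i => ρ (j i)) (fun i => x (j i)) M hjM
    exact ⟨j ∘ k, hj.comp hk, Or.inl ⟨φ, τ, hτ⟩⟩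
  · have hev : ∀ n : ℕ, ∀ᶠ i in atTop, (n : ℝ) + 1 ≤ maxDisplacement S (ρ i) (x i) := fun n => by
      have h1 := not_frequently.1 fun h => hM ⟨(n : ℝ) + 1, h⟩
      exact h1.mono fun i hi => (not_le.1 hi).le
    obtain ⟨j, hj, hgrow⟩ := extraction_forall_of_eventually hev
    have hmoved : ∀ i, ∃ g : G, ρ (j i) g (x (j i)) ≠ x (j i) := fun i => by
      by_contra! hfix
      have h0 : maxDisplacement S (ρ (j i)) (x (j i)) = 0 := by simp [maxDisplacement, hfix]
      have h1 := hgrow i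
      rw [h0, NNReal.coe_zero] at h1
      linarith [(i.cast_nonneg : (0 : ℝ) ≤ i)]
    obtain ⟨k, hk, T, hT, B, hB⟩ := exists_subseq_convergesTo_rTree hX hgeod hS
      (fun i => ⟨ρ (j i), x (j i), hmoved i⟩) (fun i => hx (j i)) hgrow
    exact ⟨j ∘ k, hj.comp hk, Or.inr ⟨fun i => x (j (k i)), fun i => hmoved (k i),
      fun i => hx (j (k i)), T, hT, B, hB⟩⟩
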